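/- Let $n\in\mathbb N$ and $d=n(n-1)/2$. A correlation matrix is a symmetric positive semidefinite real matrix with unit diagonal. For an $n\times n$ real matrix $M$, let $\operatorname{vec}(M)\in\mathbb R^{n^2}$ be the vector of stacked columns of $M$, let $\operatorname{vecl}(M)\in\mathbb R^{d}$ be the vector of its elements below the diagonal, and let $E_l$ be the $d\times n^2$ elimination matrix, i.e. the unique matrix with $\operatorname{vecl}(M)=E_l\operatorname{vec}(M)$ for all $M$. For a symmetric positive semidefinite matrix $M=Q\,\mathrm{diag}(\lambda_1,\dots,\lambda_n)Q'$ with $Q$ orthogonal, put $\log M=Q\,\mathrm{diag}(\log\lambda_1,\dots,\log\lambda_n)Q'$, with the convention $\log 0:=0$ if $M$ is singular; for positive definite $M$ this is the matrix logarithm. Let $C$ be a non-singular $n\times n$ correlation matrix and let $\hat C_T$, $T\in\mathbb N$, be random $n\times n$ matrices on a common probability space such that, for all sufficiently large $T$, $\hat C_T$ is almost surely a (possibly singular) correlation matrix. Put $$\gamma=\operatorname{vecl}(\log C),\qquad \hat\gamma_T=\operatorname{vecl}(\log\hat C_T),$$ and let $\phi$ and $\hat\phi_T$ be the vectors obtained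 by applying the Fisher transformation $\rho\mapsto\tfrac12\log\frac{1+\rho}{1-\rho}$ to each element of $\operatorname{vecl}(C)$ and $\operatorname{vecl}(\hat C_T)$, respectively (with the value $0$ by convention at $\rho=\pm1$). Let $A$ be the $n^2\times n^2$ Jacobian matrix $A=\partial\operatorname{vec}(C)/\partial\operatorname{vec}(\log C)$, that is, the Jacobian at $G=\log C$ of the map $\operatorname{vec}(G)\mapsto\operatorname{vec}(e^{G})$ on $\mathbb R^{n^2}$. Let $\Omega$ be a (possibly singular) positive semidefinite $n^2\times n^2$ matrix and suppose that, as $T\to\infty$, $$\sqrt T\,\bigl(\operatorname{vec}(\hat C_T)-\operatorname{vec}(C)\bigr)\overset{d}{\to}N(0,\Omega).$$ Then the following hold. 1. The Jacobian $A$ exists and is non-singular, and for every orthogonal $Q$ and real $\lambda_1,\dots,\lambda_n$ with $\log C=Q\,\mathrm{diag}(\lambda_1,\dots,\lambda_n)Q'$ one has $A=(Q\otimes Q)\,\Xi\,(Q\otimes Q)'$, where $\Xi$ is the $n^2\times n^2$ diagonal matrix whose entry at position $(i-1)n+j$ is $\xi_{ij}=e^{\lambda_i}$ if $\lambda_i=\lambda_j$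 and $\xi_{ij}=\frac{e^{\lambda_i}-e^{\lambda_j}}{\lambda_i-\lambda_j}$ otherwise. 2. $\sqrt T(\hat\gamma_T-\gamma)\overset{d}{\to}N\bigl(0,\;E_lA^{-1}\Omega A^{-1}E_l'\bigr)$. 3. $\sqrt T(\hat\phi_T-\phi)\overset{d}{\to}N\bigl(0,\;D_cE_l\Omega E_l'D_c\bigr)$, where $c=\operatorname{vecl}(C)$ and $D_c=\mathrm{diag}\bigl(\tfrac1{1-c_1^2},\dots,\tfrac1{1-c_d^2}\bigr)$. -/

import Mathlib

open MeasureTheory ProbabilityTheory Filter Matrix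
open scoped Kronecker

noncomputable section

/-- A correlation matrix: a positive semidefinite symmetric real matrix with unit diagonal. -/
def IsCorrelationMatrix {n : ℕ} (M : Matrix (Fin n) (Fin n) ℝ) : Prop :=
  M.PosSemidef ∧ ∀ i, M i i = 1

/-- The logarithm of a symmetric real matrix, `Q diag(log λ₁, …, log λₙ) Qᵀ` for a spectral
decomposition `Q diag(λ₁, …, λₙ) Qᵀ`. On singular symmetric matrices the convention `log 0 = 0`
is used. -/
def matrixLog {n : ℕ} (M : Matrix (Fin n) (Fin n) ℝ) : Matrix (Fin n) (Fin n) ℝ :=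
  cfc Real.log M

/-- Positions strictly below the diagonal. As in `Matrix.vec`, a position is a pair
`(column, row)`. -/
abbrev LowerIndex (n : ℕ) : Type := {p : Fin n × Fin n // p.1 < p.2}

/-- The vector of the elements below the diagonal. -/
def vecl {n : ℕ} (M : Matrix (Fin n) (Fin n) ℝ) : LowerIndex n → ℝ :=
  fun p => M p.1.2 p.1.1

/-- The elimination matrix `E_l`. -/
def elimLower (n : ℕ) : Matrix (LowerIndex n) (Fin n × Fin n) ℝ :=
  Matrix.of fun p q => if p.1 = q then 1 else 0

/-- `E_l` is the only matrix with `vecl M = E_l vec M` for all `M`. -/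
theorem elimLower_unique {n : ℕ} (E : Matrix (LowerIndex n) (Fin n × Fin n) ℝ) :
    (∀ M : Matrix (Fin n) (Fin n) ℝ, vecl M = E *ᵥ vec M) ↔ E = elimLower n := by
  constructor
  · intro h
    ext p q
    have h1 := congrFun (h (Matrix.single q.2 q.1 1)) p
    rw [vec_single, mulVec_single_one] at h1
    rw [elimLower, of_apply]
    rw [Matrix.col_apply] at h1
    rw [← h1]
    simp only [vecl, Matrix.single_apply, Prod.ext_iff]
    congr 1
    exact propext ⟨fun h => ⟨h.2.symm, h.1.symm⟩, fun h => ⟨h.2.symm, h.1.symm⟩⟩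
  · rintro rfl M
    ext p
    simp [elimLower, vecl, mulVec, dotProduct, vec]

/-- The parametrization `γ(C) = vecl (log C)`. -/
def gammaVec {n : ℕ} (M : Matrix (Fin n) (Fin n) ℝ) : LowerIndex n → ℝ :=
  vecl (matrixLog M)

/-- The Fisher transformation. -/
def fisher (r : ℝ) : ℝ := 1 / 2 * Real.log ((1 + r) / (1 - r))

/-- The vector of the Fisher transforms of the elements below the diagonal. -/
def phiVec {n : ℕ} (M : Matrix (Fin n) (Fin n) ℝ) : LowerIndex n → ℝ :=
  fun p => fisher (vecl M p)

/-- The diagonal matrix `D_c` with entries `1 / (1 - cᵢ²)`, where `c = vecl C`. -/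
def fisherJacobian {n : ℕ} (C : Matrix (Fin n) (Fin n) ℝ) :
    Matrix (LowerIndex n) (LowerIndex n) ℝ :=
  Matrix.diagonal fun p => 1 / (1 - vecl C p ^ 2)

/-- The map `vec G ↦ vec (e^G)` on `ℝ^(n²)`. -/
def vecExp {n : ℕ} (v : Fin n × Fin n → ℝ) : Fin n × Fin n → ℝ :=
  vec (NormedSpace.exp (Matrix.of fun i j => v (j, i)))

/-- The Jacobian matrix `A = ∂ vec C / ∂ vec (log C)`: the Jacobian of `vec G ↦ vec (e^G)` with
respect to all `n²` entries of `G`, taken at `G = log C`. -/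
def jacobianA {n : ℕ} (C : Matrix (Fin n) (Fin n) ℝ) :
    Matrix (Fin n × Fin n) (Fin n × Fin n) ℝ :=
  LinearMap.toMatrix' (fderiv ℝ vecExp (vec (matrixLog C))).toLinearMap

/-- The divided difference of the exponential function at `a` and `b`. -/
def xi (a b : ℝ) : ℝ :=
  if a = b then Real.exp a else (Real.exp a - Real.exp b) / (a - b)

/-- `√T (X_T - x)` converges in distribution to the (possibly degenerate) centred normal law with
covariance matrix `S`, as `T → ∞`. -/
def RootTNormal {Ω κ : Type*} [Fintype κ] [DecidableEq κ] [MeasurableSpace Ω]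
    (P : Measure Ω) [IsProbabilityMeasure P] (X : ℕ → Ω → κ → ℝ) (x : κ → ℝ)
    (S : Matrix κ κ ℝ) : Prop :=
  TendstoInDistribution
    (fun (T : ℕ) (ω : Ω) => (WithLp.toLp 2 (Real.sqrt T • (X T ω - x)) : EuclideanSpace ℝ κ))
    atTop id (fun _ => P) (multivariateGaussian 0 S)

end

/-! Both limits are instances of the delta method; the work lies in the derivative of the matrix
logarithm at `C`. Conjugation by `Q` reduces the derivative of `exp` at a symmetric matrix to a
diagonal base point. There each matrix unit is an eigendirection, with the divided difference `xi`
as eigenvalue (`hasDerivAt_exp_diagonal_add_smul_single`), which yields the spectral form of `A`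
(`toMatrix_fderiv_vecExp`). Since `exp` is strictly increasing, all `xi` are positive, so `A` is
invertible. On Hermitian matrices near `C` the logarithm is a continuous right inverse of `exp`,
hence has derivative `A⁻¹` within that set (`hasFDerivWithinAt_vec_matrixLog`). As `matrixLog` is
zero off the Hermitian matrices, the delta method is stated for derivatives within a set that
contains the estimators almost surely. -/

/-! ### The delta method in normed spaces. -/

section DeltaMethod

open Topology

/-- A sequence converging in distribution is bounded in probability. -/
theorem TendstoInDistribution.exists_forall_eventually_measure_norm_lt
    {E Ω Ω' : Type*} [NormedAddCommGroup E] [MeasurableSpace E] [BorelSpace E] [CompleteSpace E]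
    [SecondCountableTopology E] [MeasurableSpace Ω] {P : Measure Ω} [IsProbabilityMeasure P]
    [MeasurableSpace Ω'] {P' : Measure Ω'} [IsProbabilityMeasure P'] {X : ℕ → Ω → E} {Z : Ω' → E}
    (h : TendstoInDistribution X atTop Z (fun _ => P) P') {a : ENNReal} (ha : 0 < a) :
    ∃ K : ℝ, 0 < K ∧ ∀ᶠ T in atTop, P {ω | K ≤ ‖X T ω‖} < a := by
  have hZ := h.aemeasurable_limit
  have : IsProbabilityMeasure (P'.map Z) := Measure.isProbabilityMeasure_map hZ
  have htight := tendsto_measure_norm_gt_of_isTightMeasureSet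
    (isTightMeasureSet_singleton (μ := P'.map Z))
  simp only [Set.mem_singleton_iff, iSup_iSup_eq_left] at htight
  obtain ⟨r, hr, hr0⟩ := ((htight.eventually_lt_const ha).and (eventually_gt_atTop 0)).exists
  -- Tightness bounds the open tail `r < ‖x‖`, whereas portmanteau needs a closed set; the closed
  -- tail at `r + 1` lies inside the open one.
  refine ⟨r + 1, by linarith, ?_⟩
  have hclosed : IsClosed {x : E | r + 1 ≤ ‖x‖} := isClosed_le continuous_const continuous_norm
  have hlim := ProbabilityMeasure.limsup_measure_closed_le_of_tendsto h.tendsto hclosed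
  have hlt : limsup (fun T => P.map (X T) {x : E | r + 1 ≤ ‖x‖}) atTop < a := by
    refine lt_of_le_of_lt hlim (lt_of_le_of_lt (measure_mono fun x hx => ?_) hr)
    have : r + 1 ≤ ‖x‖ := hx
    change r < ‖x‖
    linarith
  filter_upwards [eventually_lt_of_limsup_lt hlt] with T hT
  rwa [Measure.map_apply_of_aemeasurable (h.forall_aemeasurable T) hclosed.measurableSet] at hT

/-- The delta method, for a function which is differentiable within a set containing the
estimators almost surely. -/
theorem TendstoInDistribution.delta_method
    {E F Ω Ω' : Type*} [NormedAddCommGroup E] [NormedSpace ℝ E] [MeasurableSpace E] [BorelSpace E]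
    [CompleteSpace E] [SecondCountableTopology E]
    [NormedAddCommGroup F] [NormedSpace ℝ F] [MeasurableSpace F] [BorelSpace F]
    [SecondCountableTopology F] [MeasurableSpace Ω] {P : Measure Ω} [IsProbabilityMeasure P]
    [MeasurableSpace Ω'] {P' : Measure Ω'} [IsProbabilityMeasure P'] {X : ℕ → Ω → E} {Z : Ω' → E}
    {x : E} {f : E → F} {L : E →L[ℝ] F} {s : Set E} (hf : HasFDerivWithinAt f L s x)
    (hs : ∀ᶠ T in atTop, ∀ᵐ ω ∂P, X T ω ∈ s)
    (h : TendstoInDistribution (fun (T : ℕ) ω => Real.sqrt T • (X T ω - x)) atTop Z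
      (fun _ => P) P')
    (hm : ∀ T : ℕ, AEMeasurable (fun ω => Real.sqrt T • (f (X T ω) - f x)) P) :
    TendstoInDistribution (fun (T : ℕ) ω => Real.sqrt T • (f (X T ω) - f x)) atTop (L ∘ Z)
      (fun _ => P) P' := by
  refine tendstoInDistribution_of_tendstoInMeasure_sub _ _ (h.continuous_comp L.continuous) ?_ hm
  rw [tendstoInMeasure_iff_norm]
  intro η hη
  rw [ENNReal.tendsto_nhds_zero]
  intro a ha
  obtain ⟨K, hK, hKev⟩ := TendstoInDistribution.exists_forall_eventually_measure_norm_lt h ha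
  -- On the event `√T ‖X - x‖ < K` this constant makes the scaled remainder at most `η / 2`.
  have hε : 0 < η / (2 * K) := by positivity
  have hlo := hf.isLittleO.def hε
  rw [eventually_nhdsWithin_iff, Metric.eventually_nhds_iff] at hlo
  obtain ⟨δ, hδ, hlo⟩ := hlo
  have hsqrt : Tendsto (fun T : ℕ => Real.sqrt T) atTop atTop :=
    Real.tendsto_sqrt_atTop.comp tendsto_natCast_atTop_atTop
  -- Once `√T > K / δ`, the same event forces `‖X - x‖ < δ`, where the first-order expansion is
  -- valid.
  filter_upwards [hKev, hs, hsqrt.eventually_gt_atTop (K / δ), eventually_gt_atTop 0]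
    with T hT hsT hTδ hT0
  refine le_trans (measure_mono_ae ?_) hT.le
  filter_upwards [hsT] with ω hω hle
  by_contra hlt
  have hsq : 0 < Real.sqrt T := Real.sqrt_pos.2 (by exact_mod_cast hT0)
  have hlt' : Real.sqrt T * ‖X T ω - x‖ < K := by
    have : ¬ K ≤ ‖Real.sqrt T • (X T ω - x)‖ := hlt
    rwa [norm_smul, Real.norm_of_nonneg hsq.le, not_le] at this
  have hdist : dist (X T ω) x < δ := by
    rw [dist_eq_norm]
    rw [div_lt_iff₀ hδ] at hTδ
    exact lt_of_mul_lt_mul_left (hlt'.trans hTδ) hsq.le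
  have hb := hlo hdist hω
  have hle' : η ≤ ‖Real.sqrt T • (f (X T ω) - f x) - L (Real.sqrt T • (X T ω - x)) - 0‖ := hle
  rw [sub_zero, map_smul, ← smul_sub, norm_smul, Real.norm_of_nonneg hsq.le] at hle'
  have : Real.sqrt T * (η / (2 * K) * ‖X T ω - x‖) < η := by
    calc Real.sqrt T * (η / (2 * K) * ‖X T ω - x‖)
        = η / (2 * K) * (Real.sqrt T * ‖X T ω - x‖) := by ring
      _ ≤ η / (2 * K) * K := by gcongr
      _ = η / 2 := by field_simp
      _ < η := by linarith
  have h2 := mul_le_mul_of_nonneg_left hb hsq.le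
  linarith

end DeltaMethod

/-! ### Linear images of Gaussian laws and the delta method for `RootTNormal`. -/

section Gaussian

variable {κ κ' : Type*} [Fintype κ] [DecidableEq κ] [Fintype κ']

/-- Multiplication by a matrix, between Euclidean spaces. -/
noncomputable def mulVecEuclidean (B : Matrix κ' κ ℝ) :
    EuclideanSpace ℝ κ →L[ℝ] EuclideanSpace ℝ κ' :=
  (Matrix.toEuclideanLin B).toContinuousLinearMap

theorem mulVecEuclidean_apply (B : Matrix κ' κ ℝ) (x : EuclideanSpace ℝ κ) :
    mulVecEuclidean B x = WithLp.toLp 2 (B *ᵥ WithLp.ofLp x) := rfl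

variable [DecidableEq κ']

theorem adjoint_mulVecEuclidean (B : Matrix κ' κ ℝ) :
    ContinuousLinearMap.adjoint (mulVecEuclidean B) = mulVecEuclidean Bᵀ := by
  rw [eq_comm, ContinuousLinearMap.eq_adjoint_iff]
  intro x y
  simp only [mulVecEuclidean_apply, EuclideanSpace.inner_eq_star_dotProduct, star_trivial]
  rw [Matrix.mulVec_transpose, dotProduct_comm, ← Matrix.dotProduct_mulVec, dotProduct_comm]

/-- A linear image of a centred multivariate Gaussian measure. -/
theorem map_mulVecEuclidean_multivariateGaussian {S : Matrix κ κ ℝ} (hS : S.PosSemidef)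
    (B : Matrix κ' κ ℝ) :
    (multivariateGaussian 0 S).map (mulVecEuclidean B) =
      multivariateGaussian 0 (B * S * Bᵀ) := by
  have hS' : (B * S * Bᵀ).PosSemidef := by
    simpa using hS.mul_mul_conjTranspose_same B
  apply IsGaussian.ext
  · simp only [id_eq, integral_id_multivariateGaussian]
    rw [ContinuousLinearMap.integral_id_map, integral_id_multivariateGaussian, map_zero]
    exact IsGaussian.integrable_id
  · ext u v
    rw [covarianceBilin_map IsGaussian.memLp_two_id, covarianceBilin_multivariateGaussian hS,
      covarianceBilin_multivariateGaussian hS', adjoint_mulVecEuclidean]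
    simp only [mulVecEuclidean_apply]
    rw [← mulVec_mulVec, ← mulVec_mulVec, mulVec_transpose, ← dotProduct_mulVec]

/-- The delta method for `RootTNormal`. -/
theorem RootTNormal.delta {Ω : Type*} [MeasurableSpace Ω] {P : Measure Ω} [IsProbabilityMeasure P]
    {X : ℕ → Ω → κ → ℝ} {x : κ → ℝ} {S : Matrix κ κ ℝ} (hS : S.PosSemidef)
    (h : RootTNormal P X x S) {f : (κ → ℝ) → κ' → ℝ} (hf : Measurable f) {B : Matrix κ' κ ℝ}
    {s : Set (κ → ℝ)} (hd : HasFDerivWithinAt f (B.mulVecLin.toContinuousLinearMap) s x)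
    (hs : ∀ᶠ T in atTop, ∀ᵐ ω ∂P, X T ω ∈ s) :
    RootTNormal P (fun T ω => f (X T ω)) (f x) (B * S * Bᵀ) := by
  -- Dividing by `√T` recovers `X T`. At `T = 0` nothing can be recovered, but the rescaled sequence
  -- is then constantly zero.
  have hX : ∀ T : ℕ, T ≠ 0 → AEMeasurable (X T) P := by
    intro T hT
    have h0 : Real.sqrt T ≠ 0 := Real.sqrt_ne_zero'.2 (by positivity)
    have h1 := (WithLp.measurable_ofLp 2 (κ → ℝ)).comp_aemeasurable (h.forall_aemeasurable T)
    refine ((h1.const_smul (Real.sqrt T)⁻¹).add_const x).congr (Eventually.of_forall fun ω => ?_)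
    simp [smul_smul, inv_mul_cancel₀ h0]
  let e := EuclideanSpace.equiv κ ℝ
  let e' := EuclideanSpace.equiv κ' ℝ
  have hd' : HasFDerivWithinAt (fun y => e'.symm (f (e y))) (mulVecEuclidean B) (e ⁻¹' s)
      (e.symm x) := by
    have h1 : HasFDerivWithinAt f (B.mulVecLin.toContinuousLinearMap) s (e (e.symm x)) := by
      simpa using hd
    exact (e'.symm.hasFDerivAt.comp_hasFDerivWithinAt _
      (h1.comp _ e.hasFDerivAt.hasFDerivWithinAt (Set.mapsTo_preimage _ _)))
  have hmain := TendstoInDistribution.delta_method (P := P)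
    (X := fun T ω => e.symm (X T ω)) (Z := id) (P' := multivariateGaussian 0 S) hd'
    hs h (by
      intro T
      rcases eq_or_ne T 0 with rfl | hT
      · simp
      · have h1 : AEMeasurable (fun ω => e'.symm (f (X T ω))) P :=
          e'.symm.continuous.measurable.comp_aemeasurable (hf.comp_aemeasurable (hX T hT))
        exact (h1.sub_const (e'.symm (f (e (e.symm x))))).const_smul (Real.sqrt T))
  refine ⟨hmain.forall_aemeasurable, aemeasurable_id, ?_⟩
  refine le_trans hmain.tendsto (le_of_eq (congrArg nhds (Subtype.ext (Eq.symm ?_))))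
  change Measure.map id _ = Measure.map (mulVecEuclidean B) _
  rw [Measure.map_id, map_mulVecEuclidean_multivariateGaussian hS]

end Gaussian

/-! ### The derivative of the matrix exponential at symmetric matrices. -/

section ExpDerivative

open scoped Matrix.Norms.L2Operator

variable {n : ℕ}

theorem diagonal_mul_single (l : Fin n → ℝ) (a b : Fin n) (c : ℝ) :
    Matrix.diagonal l * Matrix.single a b c = l a • Matrix.single a b c := by
  ext i j
  by_cases h : a = i
  · subst h; simp [Matrix.diagonal_mul]
  · simp [Matrix.diagonal_mul, h]

theorem single_mul_diagonal (l : Fin n → ℝ) (a b : Fin n) (c : ℝ) :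
    Matrix.single a b c * Matrix.diagonal l = l b • Matrix.single a b c := by
  ext i j
  by_cases h : b = j
  · subst h; simp [Matrix.mul_diagonal, mul_comm]
  · simp [Matrix.mul_diagonal, h]

theorem exp_eq_one_add_of_mul_self_eq_zero {N : Matrix (Fin n) (Fin n) ℝ} (hN : N * N = 0) :
    NormedSpace.exp N = 1 + N := by
  simp only [NormedSpace.exp_eq_tsum ℝ]
  rw [tsum_eq_sum (s := Finset.range 2)]
  · simp [Finset.sum_range_succ]
  · intro k hk
    obtain ⟨m, rfl⟩ : ∃ m, k = 2 + m := Nat.exists_eq_add_of_le (not_lt.1 (mt Finset.mem_range.2 hk))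
    rw [pow_add, pow_two, hN, zero_mul, smul_zero]

theorem exp_diagonal_eq (l : Fin n → ℝ) :
    NormedSpace.exp (Matrix.diagonal l) = Matrix.diagonal fun i => Real.exp (l i) := by
  rw [Matrix.exp_diagonal]
  congr 1
  ext i
  rw [Pi.coe_exp, Real.exp_eq_exp_ℝ]

/-- The exponential is affine along off-diagonal unit directions at a diagonal matrix. -/
theorem exp_diagonal_add_smul_single (l : Fin n → ℝ) {a b : Fin n} (hab : a ≠ b) (t : ℝ) :
    NormedSpace.exp (Matrix.diagonal l + t • Matrix.single a b (1 : ℝ)) =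
      Matrix.diagonal (fun i => Real.exp (l i)) +
        t • xi (l a) (l b) • Matrix.single a b (1 : ℝ) := by
  have hsq : Matrix.single a b (1 : ℝ) * Matrix.single a b (1 : ℝ) = 0 :=
    Matrix.single_mul_single_of_ne _ _ _ _ hab.symm _
  have hsq' (s : ℝ) : (s • Matrix.single a b (1 : ℝ)) * (s • Matrix.single a b (1 : ℝ)) = 0 := by
    rw [smul_mul_smul_comm, hsq, smul_zero]
  by_cases hl : l a = l b
  · rw [Matrix.exp_add_of_commute _ _ (by
      rw [commute_iff_eq, mul_smul_comm, smul_mul_assoc, diagonal_mul_single, single_mul_diagonal,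
        hl]), exp_diagonal_eq, exp_eq_one_add_of_mul_self_eq_zero (hsq' t), mul_add, mul_one,
      mul_smul_comm, diagonal_mul_single, xi, if_pos hl]
  · have hne : l b - l a ≠ 0 := sub_ne_zero.2 (Ne.symm hl)
    -- Conjugating a diagonal matrix by `1 + s E_ab` adds `s (l b - l a) E_ab` to it; this `s` makes
    -- that term equal `t E_ab`, and the exponential commutes with the conjugation.
    set s := t / (l b - l a) with hs
    set N := s • Matrix.single a b (1 : ℝ) with hNdef
    have hN : N * N = 0 := hsq' s
    have h1 : (1 + N) * (1 - N) = 1 := by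
      rw [mul_sub, mul_one, add_mul, one_mul, hN]; simp
    have hinv : (1 + N)⁻¹ = 1 - N := Matrix.inv_eq_right_inv h1
    have hconj (d : Fin n → ℝ) : (1 + N) * Matrix.diagonal d * (1 - N) =
        Matrix.diagonal d + (s * (d b - d a)) • Matrix.single a b (1 : ℝ) := by
      have h2 : N * Matrix.diagonal d * N = 0 := by
        rw [hNdef, smul_mul_assoc, single_mul_diagonal, smul_mul_smul_comm, smul_mul_assoc, hsq,
          smul_zero, smul_zero]
      rw [mul_sub, mul_one, add_mul, one_mul, add_mul, h2, hNdef, smul_mul_assoc, mul_smul_comm,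
        single_mul_diagonal, diagonal_mul_single]
      module
    have harg : Matrix.diagonal l + t • Matrix.single a b (1 : ℝ) =
        (1 + N) * Matrix.diagonal l * (1 + N)⁻¹ := by
      rw [hinv, hconj, hs, div_mul_cancel₀ _ hne]
    rw [harg, Matrix.exp_conj _ _ (IsUnit.of_mul_eq_one _ h1), hinv, exp_diagonal_eq, hconj,
      smul_smul, xi, if_neg hl, hs]
    congr 2
    have : l a - l b ≠ 0 := sub_ne_zero.2 hl
    field_simp
    ring

theorem exp_diagonal_add_smul_single_self (l : Fin n → ℝ) (a : Fin n) (t : ℝ) :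
    NormedSpace.exp (Matrix.diagonal l + t • Matrix.single a a (1 : ℝ)) =
      Matrix.diagonal (fun i => Real.exp (l i)) +
        (Real.exp (l a + t) - Real.exp (l a)) • Matrix.single a a (1 : ℝ) := by
  have h (d : Fin n → ℝ) (c : ℝ) : Matrix.diagonal d + c • Matrix.single a a (1 : ℝ) =
      Matrix.diagonal (d + Pi.single a c) := by
    ext i j
    by_cases hij : i = j
    · subst hij; simp [Matrix.single_apply, Pi.single_apply, eq_comm]
    · simp only [Matrix.add_apply, Matrix.smul_apply, Matrix.diagonal_apply_ne _ hij,
        Matrix.single_apply]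
      rw [if_neg (fun h => hij (h.1.symm.trans h.2))]
      simp
  rw [h, h, exp_diagonal_eq]
  congr 1
  ext i
  by_cases hi : i = a
  · subst hi; simp
  · simp [hi]

/-- The derivative of the exponential at a diagonal matrix in a unit direction. -/
theorem hasDerivAt_exp_diagonal_add_smul_single (l : Fin n → ℝ) (a b : Fin n) :
    HasDerivAt (fun t : ℝ => NormedSpace.exp (Matrix.diagonal l + t • Matrix.single a b (1 : ℝ)))
      (xi (l a) (l b) • Matrix.single a b (1 : ℝ)) 0 := by
  by_cases hab : a = b
  · subst hab
    simp only [exp_diagonal_add_smul_single_self]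
    refine HasDerivAt.const_add _ (HasDerivAt.smul_const ?_ _)
    have := ((hasDerivAt_id (0 : ℝ)).const_add (l a)).exp.sub_const (Real.exp (l a))
    simpa [xi] using this
  · simp only [exp_diagonal_add_smul_single l hab]
    simpa using ((hasDerivAt_id (0 : ℝ)).smul_const
      (xi (l a) (l b) • Matrix.single a b (1 : ℝ))).const_add
        (Matrix.diagonal fun i => Real.exp (l i))

/-- Vectorization as a continuous linear equivalence. -/
noncomputable def vecCLE (n : ℕ) : Matrix (Fin n) (Fin n) ℝ ≃L[ℝ] (Fin n × Fin n → ℝ) :=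
  LinearEquiv.toContinuousLinearEquiv
    { toFun := vec
      invFun := fun v => Matrix.of fun i j => v (j, i)
      map_add' := fun _ _ => rfl
      map_smul' := fun _ _ => rfl
      left_inv := fun _ => rfl
      right_inv := fun _ => rfl }

theorem vecCLE_apply (M : Matrix (Fin n) (Fin n) ℝ) : vecCLE n M = vec M := rfl

theorem vecCLE_symm_vec (M : Matrix (Fin n) (Fin n) ℝ) : (vecCLE n).symm (vec M) = M := rfl

theorem vecExp_eq (v : Fin n × Fin n → ℝ) :
    vecExp v = vecCLE n (NormedSpace.exp ((vecCLE n).symm v)) := rfl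

theorem differentiable_vecExp : Differentiable ℝ (vecExp (n := n)) := by
  intro v
  have h : DifferentiableAt ℝ (NormedSpace.exp : Matrix (Fin n) (Fin n) ℝ → _)
      ((vecCLE n).symm v) := (NormedSpace.exp_analytic (𝕂 := ℝ) _).differentiableAt
  exact (vecCLE n).differentiableAt.comp v (h.comp v (vecCLE n).symm.differentiableAt)

theorem xi_comm (a b : ℝ) : xi a b = xi b a := by
  unfold xi
  by_cases h : a = b
  · simp [h]
  · rw [if_neg h, if_neg (Ne.symm h), ← neg_sub (Real.exp b), ← neg_sub b, neg_div_neg_eq]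

theorem xi_pos (a b : ℝ) : 0 < xi a b := by
  unfold xi
  split_ifs with h
  · exact Real.exp_pos a
  · rcases lt_or_gt_of_ne h with h | h
    · exact div_pos_of_neg_of_neg (sub_neg.2 (Real.exp_lt_exp.2 h)) (sub_neg.2 h)
    · exact div_pos (sub_pos.2 (Real.exp_lt_exp.2 h)) (sub_pos.2 h)

theorem vec_single_eq (a b : Fin n) :
    vec (Matrix.single a b (1 : ℝ)) = Pi.single (b, a) 1 := by
  ext ⟨i, j⟩
  simp [Matrix.single_apply, Pi.single_apply, Prod.ext_iff, and_comm, eq_comm]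

theorem kronecker_self_mem_orthogonalGroup {Q : Matrix (Fin n) (Fin n) ℝ}
    (hQ : Q ∈ Matrix.orthogonalGroup (Fin n) ℝ) : (Q ⊗ₖ Q) * (Q ⊗ₖ Q)ᵀ = 1 := by
  rw [← Matrix.kroneckerMap_transpose, ← Matrix.mul_kronecker_mul,
    show Q * Qᵀ = 1 from (Matrix.mem_orthogonalGroup_iff (Fin n) ℝ).1 hQ, Matrix.one_kronecker_one]

/-- The spectral expression of the Jacobian of `vec G ↦ vec (e^G)` at a symmetric matrix. -/
theorem toMatrix_fderiv_vecExp {Q : Matrix (Fin n) (Fin n) ℝ} {l : Fin n → ℝ}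
    (hQ : Q ∈ Matrix.orthogonalGroup (Fin n) ℝ) :
    LinearMap.toMatrix' (fderiv ℝ vecExp (vec (Q * Matrix.diagonal l * Qᵀ))).toLinearMap =
      (Q ⊗ₖ Q) * Matrix.diagonal (fun p => xi (l p.1) (l p.2)) * (Q ⊗ₖ Q)ᵀ := by
  have hQQ : Q * Qᵀ = 1 := (Matrix.mem_orthogonalGroup_iff (Fin n) ℝ).1 hQ
  have hinv : Q⁻¹ = Qᵀ := Matrix.inv_eq_right_inv hQQ
  have hKK := kronecker_self_mem_orthogonalGroup hQ
  set G := Q * Matrix.diagonal l * Qᵀ with hG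
  set A := LinearMap.toMatrix' (fderiv ℝ vecExp (vec G)).toLinearMap with hA
  -- Column by column, this says that `Q E_ab Qᵀ` is an eigenvector of the derivative at `G` with
  -- eigenvalue `xi (l a) (l b)`. Both sides are computed as derivatives along the line through `G`
  -- in that direction.
  suffices h : A * (Q ⊗ₖ Q) =
      (Q ⊗ₖ Q) * Matrix.diagonal (fun p : Fin n × Fin n => xi (l p.1) (l p.2)) by
    rw [← h, mul_assoc, hKK, mul_one]
  apply Matrix.ext_of_mulVec_single
  rintro ⟨b, a⟩
  rw [← vec_single_eq, ← mulVec_mulVec, ← mulVec_mulVec, Matrix.kronecker_mulVec_vec]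
  have hdiag : Matrix.diagonal (fun p : Fin n × Fin n => xi (l p.1) (l p.2)) *ᵥ
      vec (Matrix.single a b (1 : ℝ)) = vec (xi (l a) (l b) • Matrix.single a b (1 : ℝ)) := by
    rw [Matrix.vec_smul, vec_single_eq]
    ext p
    rw [mulVec_diagonal]
    by_cases hp : p = (b, a)
    -- `vec` lists the column first, so the roles of `a` and `b` are exchanged; the symmetry of `xi`
    -- makes this harmless.
    · subst hp; simp [xi_comm]
    · simp [hp]
  rw [hdiag, Matrix.kronecker_mulVec_vec, hA, LinearMap.toMatrix'_mulVec]
  have hfd := (differentiable_vecExp (vec G)).hasFDerivAt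
  set H := Q * Matrix.single a b (1 : ℝ) * Qᵀ with hH
  have hline : HasDerivAt (fun t : ℝ => vec G + t • vec H) (vec H) 0 := by
    simpa using ((hasDerivAt_id (0 : ℝ)).smul_const (vec H)).const_add (vec G)
  have h1 : HasDerivAt (fun t : ℝ => vecExp (vec G + t • vec H))
      (fderiv ℝ vecExp (vec G) (vec H)) 0 := by
    have hfd' : HasFDerivAt vecExp (fderiv ℝ vecExp (vec G)) (vec G + (0 : ℝ) • vec H) := by
      rwa [zero_smul, add_zero]
    exact hfd'.comp_hasDerivAt (0 : ℝ) hline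
  have h2 : HasDerivAt (fun t : ℝ => vecExp (vec G + t • vec H))
      (vec (Q * (xi (l a) (l b) • Matrix.single a b (1 : ℝ)) * Qᵀ)) 0 := by
    have h3 := ((hasDerivAt_exp_diagonal_add_smul_single l a b).const_mul Q).mul_const Qᵀ
    have h4 := (vecCLE n).hasFDerivAt.comp_hasDerivAt (0 : ℝ) h3
    refine h4.congr_of_eventuallyEq (Eventually.of_forall fun t => ?_)
    have harg : (vecCLE n).symm (vec G + t • vec H) =
        Q * (Matrix.diagonal l + t • Matrix.single a b (1 : ℝ)) * Q⁻¹ := by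
      rw [map_add, map_smul, vecCLE_symm_vec, vecCLE_symm_vec, hinv, mul_add, add_mul,
        mul_smul_comm, smul_mul_assoc]
    change vecExp (vec G + t • vec H) = _
    rw [vecExp_eq, harg, Matrix.exp_conj _ _ (IsUnit.of_mul_eq_one _ hQQ), hinv]
    rfl
  exact h1.unique h2

theorem exists_orthogonal_diagonalization {M : Matrix (Fin n) (Fin n) ℝ} (hM : M.IsHermitian) :
    ∃ Q ∈ Matrix.orthogonalGroup (Fin n) ℝ, ∃ l : Fin n → ℝ, M = Q * Matrix.diagonal l * Qᵀ := by
  refine ⟨hM.eigenvectorUnitary, hM.eigenvectorUnitary.2, hM.eigenvalues, ?_⟩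
  conv_lhs => rw [hM.spectral_theorem]
  rfl

theorem isHermitian_matrixLog (M : Matrix (Fin n) (Fin n) ℝ) : (matrixLog M).IsHermitian :=
  cfc_predicate Real.log M

theorem isUnit_jacobianA (C : Matrix (Fin n) (Fin n) ℝ) : IsUnit (jacobianA C) := by
  obtain ⟨Q, hQ, l, h⟩ := exists_orthogonal_diagonalization (isHermitian_matrixLog C)
  have hK := kronecker_self_mem_orthogonalGroup hQ
  rw [jacobianA, h, toMatrix_fderiv_vecExp hQ]
  refine ((IsUnit.of_mul_eq_one _ hK).mul ?_).mul
    (IsUnit.of_mul_eq_one _ (mul_eq_one_comm.1 hK))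
  rw [Matrix.isUnit_diagonal, Pi.isUnit_iff]
  exact fun p => (xi_pos _ _).ne'.isUnit

/-- This symmetry lets the limit covariance carry `A⁻¹` on both sides of `Ω` instead of a transpose
on the right. -/
theorem transpose_jacobianA (C : Matrix (Fin n) (Fin n) ℝ) : (jacobianA C)ᵀ = jacobianA C := by
  obtain ⟨Q, hQ, l, h⟩ := exists_orthogonal_diagonalization (isHermitian_matrixLog C)
  rw [jacobianA, h, toMatrix_fderiv_vecExp hQ]
  simp [Matrix.transpose_mul, mul_assoc]

end ExpDerivative

/-! ### Measurability and derivative of the matrix logarithm. -/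

section LogDerivative

open scoped Matrix.Norms.L2Operator Topology

variable {n : ℕ}

/-- Continuous functions which are eventually equal to `Real.log` at each point. -/
noncomputable def approxLog (k : ℕ) (x : ℝ) : ℝ :=
  x * Real.log x * (x / max (x ^ 2) (1 / ((k : ℝ) + 1)))

theorem continuous_approxLog (k : ℕ) : Continuous (approxLog k) := by
  refine Real.continuous_mul_log.mul (continuous_id.div (by fun_prop) fun x => ?_)
  exact (lt_max_of_lt_right (by positivity)).ne'

theorem eventually_approxLog_eq (x : ℝ) : ∀ᶠ k in atTop, approxLog k x = Real.log x := by
  rcases eq_or_ne x 0 with rfl | hx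
  · simp [approxLog]
  · filter_upwards [tendsto_one_div_add_atTop_nhds_zero_nat.eventually_lt_const
      (show (0 : ℝ) < x ^ 2 by positivity)] with k hk
    rw [approxLog, max_eq_left hk.le]
    field_simp

theorem isClosed_isHermitian :
    IsClosed {M : Matrix (Fin n) (Fin n) ℝ | M.IsHermitian} :=
  isClosed_eq continuous_star continuous_id

/-- `Real.log` is discontinuous at zero, so continuity of the functional calculus fails to apply on
singular matrices. Replacing it by the continuous `approxLog k` gives functions continuous on the
closed set of Hermitian matrices, and their pointwise limit is measurable. -/
theorem measurable_matrixLog_entry (i j : Fin n) :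
    Measurable fun v : Fin n × Fin n → ℝ => matrixLog ((vecCLE n).symm v) i j := by
  classical
  set s : Set (Fin n × Fin n → ℝ) := {v | ((vecCLE n).symm v).IsHermitian} with hs
  have hsc : IsClosed s := isClosed_isHermitian.preimage (vecCLE n).symm.continuous
  have hentry : Continuous fun M : Matrix (Fin n) (Fin n) ℝ => M i j :=
    continuous_id.matrix_elem i j
  refine measurable_of_tendsto_metrizable
    (f := fun k v => s.piecewise (fun v => cfc (approxLog k) ((vecCLE n).symm v) i j) 0 v)
    (fun k => ?_) (tendsto_pi_nhds.2 fun v => ?_)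
  · refine ContinuousOn.measurable_piecewise ?_ continuousOn_const hsc.measurableSet
    refine hentry.comp_continuousOn ?_
    exact ContinuousOn.cfc_of_mem_nhdsSet (s := Set.univ) _ Filter.univ_mem
      (vecCLE n).symm.continuous.continuousOn (fun v hv => hv)
      (continuous_approxLog k).continuousOn
  · by_cases hv : v ∈ s
    · simp only [Set.piecewise_eq_of_mem _ _ _ hv]
      refine tendsto_const_nhds.congr' ?_
      -- A finite spectrum allows one `k` beyond which `approxLog k` agrees with `Real.log` at every
      -- eigenvalue, including zero.
      have hfin := Matrix.finite_real_spectrum (A := (vecCLE n).symm v)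
      filter_upwards [(eventually_all_finite hfin).2 fun x _ => eventually_approxLog_eq x]
        with k hk
      rw [matrixLog, cfc_congr fun x hx => (hk x hx).symm]
    · simp only [Set.piecewise_eq_of_notMem _ _ _ hv]
      have h0 : matrixLog ((vecCLE n).symm v) = 0 := cfc_apply_of_not_predicate _ hv
      rw [h0]
      exact tendsto_const_nhds

theorem measurable_gammaVec :
    Measurable fun v : Fin n × Fin n → ℝ => gammaVec ((vecCLE n).symm v) :=
  measurable_pi_lambda _ fun p => measurable_matrixLog_entry p.1.2 p.1.1

theorem exp_matrixLog {M : Matrix (Fin n) (Fin n) ℝ} (hM : M.IsHermitian)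
    (hpos : spectrum ℝ M ⊆ Set.Ioi 0) : NormedSpace.exp (matrixLog M) = M := by
  have hlog : ContinuousOn Real.log (spectrum ℝ M) :=
    Real.continuousOn_log.mono fun x hx => (hpos hx).ne'
  have hexp := CFC.real_exp_eq_normedSpace_exp (a := matrixLog M) (isHermitian_matrixLog M)
  have hcomp := cfc_comp' Real.exp Real.log M Real.continuous_exp.continuousOn hlog hM
  have hid : cfc (fun x => Real.exp (Real.log x)) M = cfc id M :=
    cfc_congr fun x hx => Real.exp_log (hpos hx)
  exact hexp.symm.trans (hcomp.symm.trans (hid.trans (cfc_id ℝ M hM)))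

theorem spectrum_subset_Ioi_of_posDef {M : Matrix (Fin n) (Fin n) ℝ} (hM : M.PosDef) :
    spectrum ℝ M ⊆ Set.Ioi 0 := by
  rw [hM.isHermitian.spectrum_real_eq_range_eigenvalues]
  rintro _ ⟨i, rfl⟩
  exact hM.eigenvalues_pos i

/-- The derivative of the logarithm along the symmetric matrices, in vectorized form. -/
theorem hasFDerivWithinAt_vec_matrixLog {C : Matrix (Fin n) (Fin n) ℝ} (hC : C.PosDef) :
    HasFDerivWithinAt (fun v => vec (matrixLog ((vecCLE n).symm v)))
      (jacobianA C)⁻¹.mulVecLin.toContinuousLinearMap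
      {v | ((vecCLE n).symm v).IsHermitian} (vec C) := by
  set s : Set (Fin n × Fin n → ℝ) := {v | ((vecCLE n).symm v).IsHermitian}
  have hA : IsUnit (jacobianA C).det := (Matrix.isUnit_iff_isUnit_det _).1 (isUnit_jacobianA C)
  have hAmul (w : Fin n × Fin n → ℝ) :
      jacobianA C *ᵥ w = fderiv ℝ vecExp (vec (matrixLog C)) w := by
    rw [jacobianA, LinearMap.toMatrix'_mulVec]; rfl
  let L : (Fin n × Fin n → ℝ) ≃L[ℝ] (Fin n × Fin n → ℝ) :=
    LinearEquiv.toContinuousLinearEquiv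
      (LinearEquiv.ofLinearMap (jacobianA C).mulVecLin (jacobianA C)⁻¹.mulVecLin
        (by rw [← Matrix.mulVecLin_mul, Matrix.mul_nonsing_inv _ hA, Matrix.mulVecLin_one])
        (by rw [← Matrix.mulVecLin_mul, Matrix.nonsing_inv_mul _ hA, Matrix.mulVecLin_one]))
  have hpos := spectrum_subset_Ioi_of_posDef hC
  have hCs : vec C ∈ s := hC.isHermitian
  -- Upper hemicontinuity of the spectrum keeps the eigenvalues positive near `C`, where `exp`
  -- undoes the logarithm.
  have hev : ∀ᶠ v in 𝓝[s] vec C, spectrum ℝ ((vecCLE n).symm v) ⊆ Set.Ioi 0 := by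
    have h1 := upperHemicontinuous_iff_forall_isOpen.1
      (upperHemicontinuous_spectrum ℝ (Matrix (Fin n) (Fin n) ℝ)) C _ isOpen_Ioi hpos
    have h2 : Tendsto (vecCLE n).symm (𝓝 (vec C)) (𝓝 C) :=
      (vecCLE n).symm.continuous.tendsto' _ _ rfl
    exact (h2.eventually h1).filter_mono nhdsWithin_le_nhds
  have hcont : Tendsto (fun v => vec (matrixLog ((vecCLE n).symm v))) (𝓝[s] vec C)
      (𝓝 (vec (matrixLog C))) := by
    refine ((vecCLE n).continuous.tendsto (matrixLog C)).comp ?_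
    have h := ContinuousOn.cfc_of_mem_nhdsSet (s := Set.Ioi 0) Real.log
      (a := (vecCLE n).symm)
      (t := s ∩ {v | spectrum ℝ ((vecCLE n).symm v) ⊆ Set.Ioi 0})
      (isOpen_Ioi.mem_nhdsSet.2 (Set.iUnion₂_subset fun v hv => hv.2))
      (vecCLE n).symm.continuous.continuousOn (fun v hv => hv.1)
      (Real.continuousOn_log.mono fun x hx => ne_of_gt hx)
    have h3 := h (vec C) ⟨hCs, hpos⟩
    rw [ContinuousWithinAt, Set.inter_comm, nhdsWithin_inter_of_mem hev] at h3
    exact h3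
  have hder : HasFDerivWithinAt vecExp (L : (Fin n × Fin n → ℝ) →L[ℝ] (Fin n × Fin n → ℝ))
      Set.univ (vec (matrixLog C)) := by
    have h : (L : (Fin n × Fin n → ℝ) →L[ℝ] (Fin n × Fin n → ℝ)) =
        fderiv ℝ vecExp (vec (matrixLog C)) := ContinuousLinearMap.ext hAmul
    rw [h]
    exact (differentiable_vecExp _).hasFDerivAt.hasFDerivWithinAt
  -- Inverse function rule: continuity of the logarithm at `C` within `s`, and `exp (log M) = M`
  -- nearby, give the derivative `A⁻¹`.
  refine HasFDerivWithinAt.of_local_left_inverse (f := vecExp) (f' := L) (t := Set.univ)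
    ?_ hder hCs ?_
  · rw [nhdsWithin_univ]
    exact hcont
  · filter_upwards [hev, self_mem_nhdsWithin] with v hv hvs
    rw [vecExp_eq, vecCLE_symm_vec, exp_matrixLog hvs hv, ContinuousLinearEquiv.apply_symm_apply]

theorem elimLower_mulVec_vec (M : Matrix (Fin n) (Fin n) ℝ) :
    elimLower n *ᵥ vec M = vecl M :=
  ((elimLower_unique _).2 rfl M).symm

theorem hasFDerivWithinAt_gammaVec {C : Matrix (Fin n) (Fin n) ℝ} (hC : C.PosDef) :
    HasFDerivWithinAt (fun v => gammaVec ((vecCLE n).symm v))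
      (elimLower n * (jacobianA C)⁻¹).mulVecLin.toContinuousLinearMap
      {v | ((vecCLE n).symm v).IsHermitian} (vec C) := by
  have h := ((elimLower n).mulVecLin.toContinuousLinearMap.hasFDerivAt).comp_hasFDerivWithinAt
    (vec C) (hasFDerivWithinAt_vec_matrixLog hC)
  refine (h.congr_fderiv (ContinuousLinearMap.ext fun w => ?_)).congr_of_eventuallyEq
    (Eventually.of_forall fun v => (elimLower_mulVec_vec _).symm) (elimLower_mulVec_vec _).symm
  exact mulVec_mulVec _ _ _

end LogDerivative

/-! ### The element-wise Fisher transformation. -/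

section Fisher

variable {n : ℕ}

theorem measurable_phiVec :
    Measurable fun v : Fin n × Fin n → ℝ => phiVec ((vecCLE n).symm v) := by
  refine measurable_pi_lambda _ fun p => ?_
  have h : Measurable fisher := by unfold fisher; fun_prop
  exact h.comp (measurable_pi_apply p.1)

theorem hasDerivAt_fisher {r : ℝ} (hr : r ^ 2 < 1) :
    HasDerivAt fisher (1 / (1 - r ^ 2)) r := by
  obtain ⟨h1, h2⟩ := abs_lt.1 ((sq_lt_one_iff_abs_lt_one r).1 hr)
  have ha : 1 + r ≠ 0 := by linarith
  have hb : 1 - r ≠ 0 := by linarith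
  have h := ((((hasDerivAt_id r).const_add 1).div ((hasDerivAt_id r).const_sub 1) hb).log
    (div_ne_zero ha hb)).const_mul (1 / 2)
  refine h.congr_deriv ?_
  have hc : 1 - r ^ 2 ≠ 0 := by linarith
  simp only [id_eq, Pi.div_apply]
  field_simp
  ring

/-- The principal minor on `i, j` equals `1 - (C i j)²` and is positive. This keeps the Fisher
transformation away from its singularities at `±1`. -/
theorem IsCorrelationMatrix.sq_lt_one {C : Matrix (Fin n) (Fin n) ℝ} (hC : IsCorrelationMatrix C)
    (hpos : C.PosDef) {i j : Fin n} (hij : i ≠ j) : C i j ^ 2 < 1 := by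
  have hdet := (hpos.submatrix (e := ![i, j]) (by
    intro a b hab
    fin_cases a <;> fin_cases b <;> simp_all [eq_comm])).det_pos
  have hsymm : C j i = C i j := by simpa using hpos.isHermitian.apply i j
  rw [Matrix.det_fin_two] at hdet
  simp [hC.2, hsymm] at hdet
  nlinarith

theorem hasFDerivWithinAt_phiVec {C : Matrix (Fin n) (Fin n) ℝ} (hC : IsCorrelationMatrix C)
    (hpos : C.PosDef) :
    HasFDerivWithinAt (fun v => phiVec ((vecCLE n).symm v))
      (fisherJacobian C * elimLower n).mulVecLin.toContinuousLinearMap Set.univ (vec C) := by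
  rw [hasFDerivWithinAt_univ, hasFDerivAt_pi']
  intro p
  have hlt : vecl C p ^ 2 < 1 := hC.sq_lt_one hpos p.2.ne'
  have h := (hasDerivAt_fisher hlt).comp_hasFDerivAt (vec C)
    (ContinuousLinearMap.proj (R := ℝ) (φ := fun _ : Fin n × Fin n => ℝ) p.1).hasFDerivAt
  refine h.congr_fderiv (ContinuousLinearMap.ext fun w => ?_)
  change 1 / (1 - vecl C p ^ 2) * w p.1 = ((fisherJacobian C * elimLower n) *ᵥ w) p
  rw [← mulVec_mulVec, fisherJacobian, mulVec_diagonal]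
  congr 1
  simp [elimLower, mulVec, dotProduct]

end Fisher

theorem mainTheorem9 {n : ℕ} {Ω : Type*} [MeasurableSpace Ω]
    (P : Measure Ω) [IsProbabilityMeasure P]
    (C : Matrix (Fin n) (Fin n) ℝ) (hC : IsCorrelationMatrix C) (hdet : C.det ≠ 0)
    (Chat : ℕ → Ω → Matrix (Fin n) (Fin n) ℝ)
    (hChat : ∀ᶠ T in atTop, ∀ᵐ ω ∂P, IsCorrelationMatrix (Chat T ω))
    (V : Matrix (Fin n × Fin n) (Fin n × Fin n) ℝ) (hV : V.PosSemidef)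
    (hlim : RootTNormal P (fun T ω => vec (Chat T ω)) (vec C) V) :
    -- the Jacobian `A` exists, is nonsingular, and has the spectral expression
    (DifferentiableAt ℝ vecExp (vec (matrixLog C)) ∧ IsUnit (jacobianA C) ∧
      ∀ (Q : Matrix (Fin n) (Fin n) ℝ) (l : Fin n → ℝ), Q ∈ Matrix.orthogonalGroup (Fin n) ℝ →
        matrixLog C = Q * Matrix.diagonal l * Qᵀ →
        jacobianA C = (Q ⊗ₖ Q) * Matrix.diagonal (fun p => xi (l p.1) (l p.2)) * (Q ⊗ₖ Q)ᵀ) ∧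
    -- the limit of the new parametrization
    RootTNormal P (fun T ω => gammaVec (Chat T ω)) (gammaVec C)
      (elimLower n * (jacobianA C)⁻¹ * V * (jacobianA C)⁻¹ * (elimLower n)ᵀ) ∧
    -- the limit of the element-wise Fisher transforms
    RootTNormal P (fun T ω => phiVec (Chat T ω)) (phiVec C)
      (fisherJacobian C * elimLower n * V * (elimLower n)ᵀ * fisherJacobian C) := by
  have hpos : C.PosDef := hC.1.posDef_iff_det_ne_zero.2 hdet
  refine ⟨⟨differentiable_vecExp _, isUnit_jacobianA C, fun Q l hQ h => ?_⟩, ?_, ?_⟩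
  · rw [jacobianA, h, toMatrix_fderiv_vecExp hQ]
  · have h := RootTNormal.delta hV hlim measurable_gammaVec (hasFDerivWithinAt_gammaVec hpos)
      (hChat.mono fun T hT => hT.mono fun ω hω => hω.1.isHermitian)
    simpa only [vecCLE_symm_vec, Matrix.transpose_mul, Matrix.transpose_nonsing_inv,
      transpose_jacobianA, Matrix.mul_assoc] using h
  · have h := RootTNormal.delta hV hlim measurable_phiVec (hasFDerivWithinAt_phiVec hC hpos)
      (Eventually.of_forall fun T => Eventually.of_forall fun ω => Set.mem_univ _)
    have hD : (fisherJacobian C)ᵀ = fisherJacobian C := Matrix.diagonal_transpose _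
    simpa only [vecCLE_symm_vec, Matrix.transpose_mul, hD, Matrix.mul_assoc] using h
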